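/- Let $F\in\mathbb{R}^{n\times m}$, with rows $F_1,\dots,F_n\in\mathbb{R}^m$, and let $y\sim\mathcal N(0,\mathbf I_m)$ be a standard Gaussian vector in $\mathbb{R}^m$. Put $$L^2(F)=\max_{v\in\{-1,1\}^n} v^TFF^Tv,\qquad L^2_{\mathrm{mxct}}(F)=\max\{\operatorname{Tr}(XFF^T) : X\in\mathbb{R}^{n\times n}\text{ symmetric},\ X\succeq 0,\ X_{ii}=1\text{ for all } i\},$$ $$\sigma_n^2(F)=\max\Big\{u^T\Big(\begin{pmatrix}1&-1\\-1&1\end{pmatrix}\otimes FF^T\Big)u : u\in\{0,1\}^{2n},\ \mathbf 1^Tu\le n\Big\},$$ and $L_{\mathrm{mxct}}(F)=\sqrt{L^2_{\mathrm{mxct}}(F)}$; all three maxima are attained. Then $\|Fy\|_1$ is integrable with $$\mathbf{E}[\|Fy\|_1]=\sqrt{\tfrac{2}{\pi}}\sum_{i=1}^n\|F_i\|_2,$$ and for every $x\ge 0$ $$\mathbf{Prob}\big[\|Fy\|_1\le \mathbf{E}[\|Fy\|_1]-x\big]\le e^{-x^2/(2L^2(F))},$$ where, if $L^2(F)=0$,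 the right-hand side is read as $0$ for $x>0$ and as $1$ for $x=0$. Moreover $L^2(F)=\sigma_n^2(F)$, $$\tfrac{2}{\pi}L^2_{\mathrm{mxct}}(F)\le L^2(F)\le L^2_{\mathrm{mxct}}(F),$$ and $L_{\mathrm{mxct}}(F)\le\sqrt n\,\|F\|_2$, where $\|F\|_2$ is the spectral norm of $F$. -/

import Mathlib

open Matrix MeasureTheory ProbabilityTheory
open scoped Kronecker

namespace MaxCutRelax

noncomputable section

variable {n m : ℕ}

/-- The `ℓ₁` norm `∑ i, |z i|` of a vector `z ∈ ℝⁿ`. -/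
def l1Norm (z : Fin n → ℝ) : ℝ := ∑ i, |z i|

/-- The Euclidean norm of the `i`-th row of `F`. -/
def rowNorm (F : Matrix (Fin n) (Fin m) ℝ) (i : Fin n) : ℝ :=
  ‖(WithLp.toLp 2 (F.row i) : EuclideanSpace ℝ (Fin m))‖

open scoped Matrix.Norms.L2Operator in
/-- The spectral norm of `F`: its operator norm between Euclidean spaces. -/
def spectralNorm₂ (F : Matrix (Fin n) (Fin m) ℝ) : ℝ := ‖F‖

/-- The values `vᵀ F Fᵀ v` for `v ∈ {-1, 1}ⁿ`. -/
def signValues (F : Matrix (Fin n) (Fin m) ℝ) : Set ℝ :=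
  {t | ∃ v : Fin n → ℝ, (∀ i, v i = -1 ∨ v i = 1) ∧ t = v ⬝ᵥ ((F * Fᵀ) *ᵥ v)}

/-- `L²(F)`, the maximum of `vᵀ F Fᵀ v` over `v ∈ {-1, 1}ⁿ`. -/
def LSq (F : Matrix (Fin n) (Fin m) ℝ) : ℝ := sSup (signValues F)

/-- The values `uᵀ ([1, -1; -1, 1] ⊗ F Fᵀ) u` for `u ∈ {0, 1}²ⁿ` with `1ᵀ u ≤ k`. -/
def sparseValues (k : ℕ) (F : Matrix (Fin n) (Fin m) ℝ) : Set ℝ :=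
  {t | ∃ u : Fin 2 × Fin n → ℝ, (∀ p, u p = 0 ∨ u p = 1) ∧ ∑ p, u p ≤ k ∧
    t = u ⬝ᵥ (((!![1, -1; -1, 1] : Matrix (Fin 2) (Fin 2) ℝ) ⊗ₖ (F * Fᵀ)) *ᵥ u)}

/-- `σₖ²(F)`, the maximum of `sparseValues k F`. -/
def sigmaSq (k : ℕ) (F : Matrix (Fin n) (Fin m) ℝ) : ℝ := sSup (sparseValues k F)

/-- The objective values `Tr (X F Fᵀ)` of the MaxCut semidefinite program, over the symmetric
`X ⪰ 0` with unit diagonal. -/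
def mxctValues (F : Matrix (Fin n) (Fin m) ℝ) : Set ℝ :=
  {t | ∃ X : Matrix (Fin n) (Fin n) ℝ, X.PosSemidef ∧ (∀ i, X i i = 1) ∧
    t = (X * (F * Fᵀ)).trace}

/-- `L²_mxct(F)`, the optimal value of the MaxCut semidefinite program. -/
def LmxctSq (F : Matrix (Fin n) (Fin m) ℝ) : ℝ := sSup (mxctValues F)

/-- `L_mxct(F)`. -/
def Lmxct (F : Matrix (Fin n) (Fin m) ℝ) : ℝ := √(LmxctSq F)

end

end MaxCutRelax

/-!
The mean of `‖F y‖₁` is the sum of the means of `|⟪Fᵢ, y⟫|`, where `⟪Fᵢ, y⟫` is a centred Gaussian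
variable of variance `‖Fᵢ‖²` (`integral_abs_inner_stdGaussian`).

For the lower tail, the function `y ↦ ‖F y‖₁` is a limit of the smooth functions
`∑ᵢ √(⟪Fᵢ, y⟫² + ε²)`. Their gradients are of the form `Fᵀ w` with `w` in the cube `[-1, 1]ⁿ`, where
the convex function `‖Fᵀ w‖²` is at most its largest value `L²(F)` at a vertex (`norm_sq_le_LSq`).
The tail bound is thus Gaussian concentration with the sharp constant
(`IsSmoothLipschitz.integral_exp_le`). That is obtained by dividing a standard Gaussian vector into
`N` independent steps of size `s = 1 / √N`. In one step, a second-order expansion of the exponential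
bounds the exponential moment of a smooth `L`-Lipschitz function by the exponential of its mean
times `exp (s² L² / 2 + O(s³))` (`exists_integral_exp_step_le`). Averaging over a step does not
leave the class of functions considered, so the steps can be iterated, and the total error `O(N s³)`
disappears as `N → ∞`. Markov's inequality for the exponential moments finishes the argument.

The maximum `σₙ²(F)` is that of `‖Fᵀ w‖²` over differences `w` of two `0`-`1` vectors with at most
`n` ones in total. Such differences lie in the cube and include all sign vectors, so
`σₙ²(F) = L²(F)`.

The feasible set of the semidefinite program is compact and contains `v vᵀ` for sign vectors `v`, which
gives `L²(F) ≤ L²_mxct(F)`. Conversely, an optimal `X` is the Gram matrix of unit vectors `bᵢ`, and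
the random signs of `⟪bᵢ, z⟫`, with `z` Gaussian, achieve on average at least `2 / π` times the
optimum (`two_div_pi_mul_LmxctSq_le`); this rests on `E[sign ⟪u, z⟫ ⟪w, z⟫] = √(2 / π) ⟪u, w⟫` for
unit vectors `u` (`integral_pmSign_mul_inner_stdGaussian`). The same Gram representation writes
`Tr (X F Fᵀ)` as a sum of squared norms and bounds it by `n ‖F‖²`.
-/

namespace MaxCutRelax

open scoped RealInnerProductSpace

/-! ### Standard Gaussian vectors -/

section Gaussian

variable {E : Type*} [NormedAddCommGroup E] [InnerProductSpace ℝ E] [FiniteDimensional ℝ E]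
  [MeasurableSpace E] [BorelSpace E]

theorem integral_abs_gaussianReal_zero_one :
    ∫ x, |x| ∂(gaussianReal 0 1) = √(2 / Real.pi) := by
  rw [integral_gaussianReal_eq_integral_smul one_ne_zero]
  have h1 : ∀ x : ℝ, gaussianPDFReal 0 1 x • |x|
      = (√(2 * Real.pi))⁻¹ * (|x| * Real.exp (-(1 / 2) * |x| ^ 2)) := by
    intro x
    simp only [gaussianPDFReal, NNReal.coe_one, smul_eq_mul, sub_zero, sq_abs]
    ring_nf
  simp_rw [h1]
  rw [integral_const_mul,
    integral_comp_abs (f := fun x : ℝ => x * Real.exp (-(1 / 2) * x ^ 2))]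
  have h2 : ∫ x in Set.Ioi (0 : ℝ), x * Real.exp (-(1 / 2) * x ^ 2) = 1 := by
    have := integral_rpow_mul_exp_neg_mul_rpow (p := 2) (q := 1) (b := 1 / 2)
      (by norm_num) (by norm_num) (by norm_num)
    simp only [Real.rpow_one, Real.rpow_ofNat] at this
    rw [this]
    norm_num [Real.rpow_neg_one]
  rw [h2, Real.sqrt_div (by norm_num), Real.sqrt_mul (by norm_num)]
  have := Real.mul_self_sqrt (show (0 : ℝ) ≤ 2 by norm_num)
  have h3 : √(2 : ℝ) ≠ 0 := by positivity
  have h4 : √Real.pi ≠ 0 := by positivity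
  field_simp
  linarith

theorem integrable_inner_stdGaussian (u : E) :
    Integrable (fun z => ⟪u, z⟫) (stdGaussian E) :=
  IsGaussian.integrable_dual (stdGaussian E) (innerSL ℝ u)

theorem map_inner_stdGaussian (u : E) :
    (stdGaussian E).map (fun z => ⟪u, z⟫) = (gaussianReal 0 1).map (fun x => ‖u‖ * x) := by
  have h := IsGaussian.map_eq_gaussianReal (μ := stdGaussian E) (innerSL ℝ u)
  rw [variance_dual_stdGaussian, integral_strongDual_stdGaussian] at h
  rw [gaussianReal_map_const_mul]
  convert h using 2
  · rfl
  · rw [mul_zero]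
  · rw [mul_one, innerSL_apply_norm]
    exact NNReal.eq (by simp)

theorem integral_abs_inner_stdGaussian (u : E) :
    ∫ z, |⟪u, z⟫| ∂(stdGaussian E) = √(2 / Real.pi) * ‖u‖ := by
  have h1 : ∫ z, |⟪u, z⟫| ∂(stdGaussian E)
      = ∫ x, |x| ∂((stdGaussian E).map (fun z => ⟪u, z⟫)) := by
    rw [integral_map (by fun_prop) (by fun_prop)]
  rw [h1, map_inner_stdGaussian, integral_map (by fun_prop) (by fun_prop)]
  simp_rw [abs_mul, abs_norm]
  rw [integral_const_mul, integral_abs_gaussianReal_zero_one, mul_comm]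

theorem integrable_inner_mul_inner_stdGaussian (u w : E) :
    Integrable (fun z => ⟪u, z⟫ * ⟪w, z⟫) (stdGaussian E) :=
  MemLp.integrable_mul (IsGaussian.memLp_dual (stdGaussian E) (innerSL ℝ u) 2 (by norm_num))
    (IsGaussian.memLp_dual (stdGaussian E) (innerSL ℝ w) 2 (by norm_num))

theorem integral_inner_mul_inner_stdGaussian (u w : E) :
    ∫ z, ⟪u, z⟫ * ⟪w, z⟫ ∂(stdGaussian E) = ⟪u, w⟫ := by
  have h := covarianceBilin_apply (μ := stdGaussian E) IsGaussian.memLp_two_id u w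
  rw [covarianceBilin_stdGaussian] at h
  simp only [integral_id_stdGaussian, sub_zero, id] at h
  rw [← h, innerSL_apply_apply]

/-- The sign of a real number, with value `1` at `0`. -/
noncomputable def pmSign (t : ℝ) : ℝ := if 0 ≤ t then 1 else -1

theorem pmSign_eq (t : ℝ) : pmSign t = -1 ∨ pmSign t = 1 := by
  unfold pmSign; split_ifs <;> simp

theorem abs_pmSign (t : ℝ) : |pmSign t| = 1 := by
  rcases pmSign_eq t with h | h <;> simp [h]

theorem pmSign_mul_self (t : ℝ) : pmSign t * t = |t| := by
  unfold pmSign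
  split_ifs with h
  · rw [abs_of_nonneg h, one_mul]
  · rw [abs_of_neg (not_le.1 h)]; ring

theorem measurable_pmSign : Measurable pmSign :=
  Measurable.ite measurableSet_Ici measurable_const measurable_const

theorem integrable_pmSign_mul_inner_stdGaussian (u w : E) :
    Integrable (fun z => pmSign ⟪u, z⟫ * ⟪w, z⟫) (stdGaussian E) := by
  refine (integrable_inner_stdGaussian w).abs.mono' ?_ (ae_of_all _ fun z => ?_)
  · exact ((measurable_pmSign.comp (by fun_prop)).mul (by fun_prop)).aestronglyMeasurable
  · rw [Real.norm_eq_abs, abs_mul, abs_pmSign, one_mul]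

/-- Since `pmSign ⟪u, z⟫ * z` is a subgradient of `|⟪·, z⟫|` at `u`, its mean is the gradient of
the mean `√(2 / π) ‖·‖`. -/
theorem integral_pmSign_mul_inner_stdGaussian {u : E} (hu : ‖u‖ = 1) (w : E) :
    ∫ z, pmSign ⟪u, z⟫ * ⟪w, z⟫ ∂(stdGaussian E) = √(2 / Real.pi) * ⟪u, w⟫ := by
  set c := ∫ z, pmSign ⟪u, z⟫ * ⟪w, z⟫ ∂(stdGaussian E) with hc
  -- so `t ↦ √(2 / π) ‖u + t w‖ - t c` has a minimum at `0`, where its derivative vanishes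
  have key : ∀ t : ℝ, √(2 / Real.pi) * ‖u‖ + t * c ≤ √(2 / Real.pi) * ‖u + t • w‖ := by
    intro t
    rw [← integral_abs_inner_stdGaussian, ← integral_abs_inner_stdGaussian, hc,
      ← integral_const_mul, ← integral_add (integrable_inner_stdGaussian u).abs
        ((integrable_pmSign_mul_inner_stdGaussian u w).const_mul t)]
    refine integral_mono ((integrable_inner_stdGaussian u).abs.add
        ((integrable_pmSign_mul_inner_stdGaussian u w).const_mul t))
        (integrable_inner_stdGaussian _).abs fun z => ?_
    simp only [inner_add_left, real_inner_smul_left]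
    have h1 : pmSign ⟪u, z⟫ * (⟪u, z⟫ + t * ⟪w, z⟫) ≤ |⟪u, z⟫ + t * ⟪w, z⟫| := by
      refine (le_abs_self _).trans ?_
      rw [abs_mul, abs_pmSign, one_mul]
    rw [mul_add, pmSign_mul_self] at h1
    linarith
  have hd : HasDerivAt (fun t : ℝ => √(2 / Real.pi) * ‖u + t • w‖ - t * c)
      (√(2 / Real.pi) * ⟪u, w⟫ - c) 0 := by
    have hl : HasDerivAt (fun t : ℝ => u + t • w) w 0 := by
      simpa using ((hasDerivAt_id (0 : ℝ)).smul_const w).const_add u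
    have hs := hl.norm_sq.sqrt (by simp [hu])
    have e : (fun t : ℝ => √(‖u + t • w‖ ^ 2)) = fun t : ℝ => ‖u + t • w‖ := by
      ext t; exact Real.sqrt_sq (norm_nonneg _)
    rw [e] at hs
    have := (hs.const_mul (√(2 / Real.pi))).sub ((hasDerivAt_id (0 : ℝ)).mul_const c)
    have e' : √(2 / Real.pi) * ⟪u, w⟫ - c = √(2 / Real.pi) *
        (2 * ⟪u + (0 : ℝ) • w, w⟫ / (2 * √(‖u + (0 : ℝ) • w‖ ^ 2))) - 1 * c := by
      rw [zero_smul, add_zero, hu, one_pow, Real.sqrt_one]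
      ring
    rw [e']
    exact this
  have hmin : IsLocalMin (fun t : ℝ => √(2 / Real.pi) * ‖u + t • w‖ - t * c) 0 :=
    Filter.Eventually.of_forall fun t => by
      have := key t
      change √(2 / Real.pi) * ‖u + (0 : ℝ) • w‖ - 0 * c ≤ √(2 / Real.pi) * ‖u + t • w‖ - t * c
      rw [zero_smul, add_zero]
      linarith
  linarith [hmin.hasDerivAt_eq_zero hd]

/-- A weak form of Fernique's theorem. -/
theorem integrable_exp_mul_norm_stdGaussian (c : ℝ) :
    Integrable (fun z => Real.exp (c * ‖z‖)) (stdGaussian E) := by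
  obtain ⟨C, hC, h⟩ := IsGaussian.exists_integrable_exp_sq (stdGaussian E)
  refine (h.const_mul (Real.exp (c ^ 2 / (4 * C)))).mono' (by fun_prop) (ae_of_all _ fun z => ?_)
  rw [Real.norm_of_nonneg (Real.exp_nonneg _), ← Real.exp_add, Real.exp_le_exp]
  -- complete the square
  have h1 : c ^ 2 / (4 * C) + C * ‖z‖ ^ 2 - c * ‖z‖ = (c - 2 * C * ‖z‖) ^ 2 / (4 * C) := by
    field_simp; ring
  have h2 : 0 ≤ (c - 2 * C * ‖z‖) ^ 2 / (4 * C) := by positivity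
  linarith

/-- Sums of independent centred Gaussian vectors add their variances. -/
theorem conv_map_smul_stdGaussian (a b : ℝ) :
    ((stdGaussian E).map (fun z => a • z)) ∗ ((stdGaussian E).map (fun z => b • z))
      = (stdGaussian E).map (fun z => √(a ^ 2 + b ^ 2) • z) := by
  have ha := Measure.isProbabilityMeasure_map (μ := stdGaussian E) (f := fun z => a • z)
    (by fun_prop)
  have hb := Measure.isProbabilityMeasure_map (μ := stdGaussian E) (f := fun z => b • z)
    (by fun_prop)
  have hc := Measure.isProbabilityMeasure_map (μ := stdGaussian E)
    (f := fun z => √(a ^ 2 + b ^ 2) • z) (by fun_prop)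
  refine Measure.ext_of_charFun (funext fun t => ?_)
  rw [charFun_conv, charFun_map_smul, charFun_map_smul, charFun_map_smul, charFun_stdGaussian,
    charFun_stdGaussian, charFun_stdGaussian, ← Complex.exp_add]
  congr 1
  simp only [norm_smul, Complex.ofReal_mul, mul_pow, ← Complex.ofReal_pow, Real.norm_eq_abs,
    sq_abs, Real.sq_sqrt (show 0 ≤ a ^ 2 + b ^ 2 by positivity)]
  push_cast
  ring

end Gaussian

/-! ### Gaussian concentration for smooth Lipschitz functions -/

section Concentration

variable {E : Type*} [NormedAddCommGroup E] [InnerProductSpace ℝ E] [MeasurableSpace E]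

/-- `g` is `L`-Lipschitz, and its first-order expansion with gradient field `a`, of norm at
most `L`, has an error of at most `K ‖h‖ ^ 2`, uniformly in the base point. -/
structure IsSmoothLipschitz (g : E → ℝ) (a : E → E) (L K : ℝ) : Prop where
  measurable_grad : Measurable a
  norm_grad_le : ∀ x, ‖a x‖ ≤ L
  abs_sub_le : ∀ x h, |g (x + h) - g x| ≤ L * ‖h‖
  abs_taylor_le : ∀ x h, |g (x + h) - g x - ⟪a x, h⟫| ≤ K * ‖h‖ ^ 2

namespace IsSmoothLipschitz

variable {g : E → ℝ} {a : E → E} {L K : ℝ}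

theorem nonneg (hg : IsSmoothLipschitz g a L K) : 0 ≤ L :=
  (norm_nonneg _).trans (hg.norm_grad_le 0)

theorem continuous (hg : IsSmoothLipschitz g a L K) : Continuous g := by
  have h : LipschitzWith ⟨L, hg.nonneg⟩ g := LipschitzWith.of_dist_le_mul fun x y => by
    rw [Real.dist_eq, dist_eq_norm]
    have := hg.abs_sub_le y (x - y)
    rwa [add_sub_cancel] at this
  exact h.continuous

theorem abs_le (hg : IsSmoothLipschitz g a L K) (x : E) (s : ℝ) (z : E) :
    |g (x + s • z)| ≤ |g x| + L * |s| * ‖z‖ := by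
  have h := hg.abs_sub_le x (s • z)
  rw [norm_smul, Real.norm_eq_abs] at h
  calc |g (x + s • z)| = |g x + (g (x + s • z) - g x)| := by ring_nf
    _ ≤ |g x| + |g (x + s • z) - g x| := abs_add_le _ _
    _ ≤ |g x| + L * |s| * ‖z‖ := by linarith

variable [FiniteDimensional ℝ E] [BorelSpace E]

theorem integrable_exp (hg : IsSmoothLipschitz g a L K) (x : E) (s : ℝ) :
    Integrable (fun z => Real.exp (g (x + s • z))) (stdGaussian E) := by
  have hc := hg.continuous
  refine ((integrable_exp_mul_norm_stdGaussian (L * |s|)).const_mul (Real.exp |g x|)).mono'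
    (by fun_prop) (ae_of_all _ fun z => ?_)
  rw [Real.norm_of_nonneg (Real.exp_nonneg _), ← Real.exp_add, Real.exp_le_exp]
  exact (le_abs_self _).trans (hg.abs_le x s z)

theorem integrable (hg : IsSmoothLipschitz g a L K) (x : E) (s : ℝ) :
    Integrable (fun z => g (x + s • z)) (stdGaussian E) := by
  have hc := hg.continuous
  refine ((integrable_const |g x|).add
    ((IsGaussian.integrable_id (μ := stdGaussian E)).norm.const_mul (L * |s|))).mono'
    (by fun_prop) (ae_of_all _ fun z => ?_)
  exact hg.abs_le x s z

theorem integrable_grad (hg : IsSmoothLipschitz g a L K) (x : E) (s : ℝ) :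
    Integrable (fun z => a (x + s • z)) (stdGaussian E) := by
  refine (integrable_const L).mono' ?_ (ae_of_all _ fun z => hg.norm_grad_le _)
  exact (hg.measurable_grad.comp (by fun_prop)).aestronglyMeasurable

/-- Gaussian averaging preserves the regularity class, with the same constants. -/
theorem gaussianAverage (hg : IsSmoothLipschitz g a L K) (s : ℝ) :
    IsSmoothLipschitz (fun x => ∫ z, g (x + s • z) ∂(stdGaussian E))
      (fun x => ∫ z, a (x + s • z) ∂(stdGaussian E)) L K where
  measurable_grad := by
    have h : StronglyMeasurable fun p : E × E => a (p.1 + s • p.2) :=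
      (hg.measurable_grad.comp (by fun_prop)).stronglyMeasurable
    exact h.integral_prod_right'.measurable
  norm_grad_le x := by
    have := norm_integral_le_of_norm_le_const (μ := stdGaussian E) (C := L)
      (ae_of_all _ fun z => hg.norm_grad_le (x + s • z))
    simpa using this
  abs_sub_le x h := by
    rw [← integral_sub (hg.integrable _ _) (hg.integrable _ _)]
    have := norm_integral_le_of_norm_le_const (μ := stdGaussian E) (C := L * ‖h‖)
      (f := fun z => g (x + h + s • z) - g (x + s • z)) (ae_of_all _ fun z => by
        rw [add_right_comm]; exact hg.abs_sub_le _ _)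
    simpa using this
  abs_taylor_le x h := by
    have h1 : ⟪∫ z, a (x + s • z) ∂(stdGaussian E), h⟫
        = ∫ z, ⟪a (x + s • z), h⟫ ∂(stdGaussian E) := by
      rw [real_inner_comm, ← integral_inner (hg.integrable_grad x s)]
      simp_rw [real_inner_comm]
    have h2 : Integrable (fun z => g (x + h + s • z) - g (x + s • z)) (stdGaussian E) :=
      (hg.integrable _ _).sub (hg.integrable _ _)
    rw [h1, ← integral_sub (hg.integrable _ _) (hg.integrable _ _),
      ← integral_sub h2 ((hg.integrable_grad x s).inner_const h)]
    have := norm_integral_le_of_norm_le_const (μ := stdGaussian E) (C := K * ‖h‖ ^ 2)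
      (f := fun z => g (x + h + s • z) - g (x + s • z) - ⟪a (x + s • z), h⟫)
      (ae_of_all _ fun z => by
        rw [add_right_comm]; exact hg.abs_taylor_le _ _)
    simpa using this

end IsSmoothLipschitz

variable [FiniteDimensional ℝ E] [BorelSpace E]

theorem exp_le_quadratic_add_cubic (u : ℝ) :
    Real.exp u ≤ 1 + u + u ^ 2 / 2 + |u| ^ 3 * Real.exp |u| := by
  have h := Complex.norm_exp_sub_sum_le_norm_mul_exp (u : ℂ) 3
  have e : Complex.exp u - ∑ m ∈ Finset.range 3, (u : ℂ) ^ m / (m.factorial : ℂ)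
      = ((Real.exp u - (1 + u + u ^ 2 / 2) : ℝ) : ℂ) := by
    simp [Finset.sum_range_succ, Nat.factorial]
  rw [e, Complex.norm_real, Complex.norm_real, Real.norm_eq_abs, Real.norm_eq_abs] at h
  linarith [(le_abs_self _).trans h]

/-- The pointwise estimate behind one small Gaussian step: `u` is the centred increment of the
function, `v` its linear part and `r ≥ 1` bounds both on the scale `s`. -/
theorem exp_le_of_abs_sub_le {u v s r L K : ℝ} (hs : 0 ≤ s) (hs1 : s ≤ 1) (hL : 0 ≤ L)
    (hK : 0 ≤ K) (hr : 1 ≤ r) (hu : |u| ≤ s * L * r) (hv : |v| ≤ s * L * r)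
    (huv : |u - v| ≤ s ^ 2 * K * r ^ 2) :
    Real.exp u ≤ 1 + u + v ^ 2 / 2
      + s ^ 3 * (6 * (L * K + L ^ 3) * Real.exp ((L + 1) * r)) := by
  have h1 := exp_le_quadratic_add_cubic u
  have h2 : u ^ 2 ≤ v ^ 2 + 2 * (s ^ 3 * (L * K) * r ^ 3) := by
    have h3 : u ^ 2 - v ^ 2 ≤ |u - v| * (|u| + |v|) := by
      calc u ^ 2 - v ^ 2 = (u - v) * (u + v) := by ring
        _ ≤ |u - v| * |u + v| := by rw [← abs_mul]; exact le_abs_self _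
        _ ≤ _ := by gcongr; exact abs_add_le _ _
    have h4 : |u - v| * (|u| + |v|) ≤ (s ^ 2 * K * r ^ 2) * (s * L * r + s * L * r) := by
      gcongr
    linarith
  have h5 : |u| ^ 3 * Real.exp |u| ≤ (s * L * r) ^ 3 * Real.exp (L * r) := by
    gcongr
    calc |u| ≤ s * (L * r) := by linarith
      _ ≤ 1 * (L * r) := by gcongr
      _ = L * r := one_mul _
  have h6 : r ^ 3 ≤ 6 * Real.exp r := by
    have := Real.pow_div_factorial_le_exp (x := r) (by linarith) 3
    norm_num [Nat.factorial] at this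
    linarith
  have h7 : 1 ≤ Real.exp (L * r) := Real.one_le_exp (by positivity)
  have h8 : s ^ 3 * (L * K) * r ^ 3 ≤ s ^ 3 * (L * K) * r ^ 3 * Real.exp (L * r) :=
    le_mul_of_one_le_right (by positivity) h7
  have h9 : s ^ 3 * (L * K + L ^ 3) * Real.exp (L * r) * r ^ 3
      ≤ s ^ 3 * (L * K + L ^ 3) * Real.exp (L * r) * (6 * Real.exp r) := by
    gcongr
  have h10 : Real.exp ((L + 1) * r) = Real.exp (L * r) * Real.exp r := by
    rw [← Real.exp_add]; ring_nf
  rw [h10]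
  linarith

/-- For a Gaussian step of size `s`, the exponential moment is the sub-Gaussian one up to an
error of order `s ^ 3`, uniformly over the regularity class. -/
theorem exists_integral_exp_step_le {L K : ℝ} (hL : 0 ≤ L) (hK : 0 ≤ K) :
    ∃ M : ℝ, ∀ (g : E → ℝ) (a : E → E), IsSmoothLipschitz g a L K →
      ∀ s : ℝ, 0 ≤ s → s ≤ 1 → ∀ x : E,
        ∫ z, Real.exp (g (x + s • z)) ∂(stdGaussian E)
          ≤ Real.exp (∫ z, g (x + s • z) ∂(stdGaussian E))
            * Real.exp (s ^ 2 * (L ^ 2 / 2) + s ^ 3 * M) := by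
  have hi1 : Integrable (fun z : E => ‖z‖) (stdGaussian E) :=
    (IsGaussian.integrable_id (μ := stdGaussian E)).norm
  have hi2 : Integrable (fun z : E => ‖z‖ ^ 2) (stdGaussian E) :=
    (IsGaussian.memLp_two_id (μ := stdGaussian E)).integrable_norm_pow (by norm_num)
  set m1 := ∫ z, ‖z‖ ∂(stdGaussian E) with hm1
  set m2 := ∫ z, ‖z‖ ^ 2 ∂(stdGaussian E) with hm2
  have hm1' : 0 ≤ m1 := integral_nonneg fun z => norm_nonneg _
  have hm2' : 0 ≤ m2 := integral_nonneg fun z => by positivity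
  let r : E → ℝ := fun z => ‖z‖ + (1 + m1 + m2)
  have hG : Integrable (fun z => 6 * (L * K + L ^ 3) * Real.exp ((L + 1) * r z))
      (stdGaussian E) := by
    refine (((integrable_exp_mul_norm_stdGaussian (L + 1)).const_mul
      (Real.exp ((L + 1) * (1 + m1 + m2)))).const_mul (6 * (L * K + L ^ 3))).congr
      (ae_of_all _ fun z => ?_)
    simp only [r]
    rw [← Real.exp_add]
    ring_nf
  refine ⟨∫ z, 6 * (L * K + L ^ 3) * Real.exp ((L + 1) * r z) ∂(stdGaussian E),
    fun g a hg s hs hs1 x => ?_⟩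
  set M := ∫ z, 6 * (L * K + L ^ 3) * Real.exp ((L + 1) * r z) ∂(stdGaussian E) with hM
  set A := ∫ z, g (x + s • z) ∂(stdGaussian E) with hA
  have hinner : Integrable (fun z => ⟪a x, z⟫) (stdGaussian E) := integrable_inner_stdGaussian _
  have hinner0 : ∫ z, ⟪a x, z⟫ ∂(stdGaussian E) = 0 :=
    integral_strongDual_stdGaussian (innerSL ℝ (a x))
  -- the average deviates from the value at the centre by `O(s)`, and even by `O(s ^ 2)`
  have hA1 : |A - g x| ≤ s * L * m1 := by
    have e : A - g x = ∫ z, (g (x + s • z) - g x) ∂(stdGaussian E) := by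
      rw [integral_sub (hg.integrable _ _) (integrable_const _)]; simp [hA]
    rw [e, hm1, ← integral_const_mul]
    refine norm_integral_le_of_norm_le (f := fun z => g (x + s • z) - g x)
      (hi1.const_mul _) (ae_of_all _ fun z => ?_)
    have := hg.abs_sub_le x (s • z)
    rw [norm_smul, Real.norm_of_nonneg hs] at this
    rw [Real.norm_eq_abs]; linarith
  have htaylor : ∀ z, |g (x + s • z) - g x - s * ⟪a x, z⟫| ≤ s ^ 2 * K * ‖z‖ ^ 2 := fun z => by
    have := hg.abs_taylor_le x (s • z)
    rw [norm_smul, Real.norm_of_nonneg hs, real_inner_smul_right] at this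
    linarith
  have hA2 : |A - g x| ≤ s ^ 2 * K * m2 := by
    have e : A - g x = ∫ z, (g (x + s • z) - g x - s * ⟪a x, z⟫) ∂(stdGaussian E) := by
      have h : Integrable (fun z => g (x + s • z) - g x) (stdGaussian E) :=
        (hg.integrable _ _).sub (integrable_const _)
      rw [integral_sub h (hinner.const_mul s),
        integral_sub (hg.integrable _ _) (integrable_const _), integral_const_mul, hinner0]
      simp [hA]
    rw [e, hm2, ← integral_const_mul]
    exact norm_integral_le_of_norm_le (f := fun z => g (x + s • z) - g x - s * ⟪a x, z⟫)
      (hi2.const_mul _) (ae_of_all _ fun z => htaylor z)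
  have hpt : ∀ z, Real.exp (g (x + s • z) - A) ≤ 1 + (g (x + s • z) - A)
      + (s * ⟪a x, z⟫) ^ 2 / 2
      + s ^ 3 * (6 * (L * K + L ^ 3) * Real.exp ((L + 1) * r z)) := by
    intro z
    have hz := norm_nonneg z
    have hr : 1 ≤ r z := by simp only [r]; linarith
    refine exp_le_of_abs_sub_le hs hs1 hL hK hr ?_ ?_ ?_
    · have h1 := hg.abs_sub_le x (s • z)
      rw [norm_smul, Real.norm_of_nonneg hs] at h1
      calc |g (x + s • z) - A| = |(g (x + s • z) - g x) - (A - g x)| := by ring_nf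
        _ ≤ |g (x + s • z) - g x| + |A - g x| := abs_sub _ _
        _ ≤ s * L * (‖z‖ + m1) := by linarith
        _ ≤ s * L * r z := by gcongr; simp only [r]; linarith
    · rw [abs_mul, abs_of_nonneg hs, mul_assoc]
      gcongr
      calc |⟪a x, z⟫| ≤ ‖a x‖ * ‖z‖ := abs_real_inner_le_norm _ _
        _ ≤ L * r z := by
          gcongr
          · exact hg.norm_grad_le x
          · simp only [r]; linarith
    · calc |g (x + s • z) - A - s * ⟪a x, z⟫|
          = |(g (x + s • z) - g x - s * ⟪a x, z⟫) - (A - g x)| := by ring_nf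
        _ ≤ |g (x + s • z) - g x - s * ⟪a x, z⟫| + |A - g x| := abs_sub _ _
        _ ≤ s ^ 2 * K * (‖z‖ ^ 2 + m2) := by linarith [htaylor z]
        _ ≤ s ^ 2 * K * r z ^ 2 := by
          gcongr
          simp only [r]
          nlinarith [mul_nonneg hz hm1', mul_nonneg hz hm2', mul_nonneg hm1' hm2']
  have hsq : Integrable (fun z => (s * ⟪a x, z⟫) ^ 2 / 2) (stdGaussian E) := by
    refine ((integrable_inner_mul_inner_stdGaussian (a x) (a x)).const_mul (s ^ 2 / 2)).congr
      (ae_of_all _ fun z => ?_)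
    ring
  have hsq' : ∫ z, (s * ⟪a x, z⟫) ^ 2 / 2 ∂(stdGaussian E) = s ^ 2 / 2 * ‖a x‖ ^ 2 := by
    rw [← real_inner_self_eq_norm_sq, ← integral_inner_mul_inner_stdGaussian (a x) (a x),
      ← integral_const_mul]
    refine integral_congr_ae (ae_of_all _ fun z => ?_)
    ring
  have hcent : Integrable (fun z => g (x + s • z) - A) (stdGaussian E) :=
    (hg.integrable _ _).sub (integrable_const _)
  have hcent' : ∫ z, (g (x + s • z) - A) ∂(stdGaussian E) = 0 := by
    rw [integral_sub (hg.integrable _ _) (integrable_const _)]; simp [hA]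
  have hexp : Integrable (fun z => Real.exp (g (x + s • z) - A)) (stdGaussian E) := by
    simp_rw [Real.exp_sub]
    exact (hg.integrable_exp x s).div_const _
  have hmain : ∫ z, Real.exp (g (x + s • z) - A) ∂(stdGaussian E)
      ≤ 1 + s ^ 2 / 2 * ‖a x‖ ^ 2 + s ^ 3 * M := by
    have hi3 : Integrable (fun z => 1 + (g (x + s • z) - A)) (stdGaussian E) :=
      (integrable_const 1).add hcent
    have hi4 : Integrable (fun z => 1 + (g (x + s • z) - A) + (s * ⟪a x, z⟫) ^ 2 / 2)
      (stdGaussian E) := hi3.add hsq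
    refine (integral_mono hexp (hi4.add (hG.const_mul (s ^ 3))) hpt).trans (le_of_eq ?_)
    rw [integral_add' hi4 (hG.const_mul (s ^ 3)), integral_add hi3 hsq,
      integral_add (integrable_const 1) hcent, hcent', hsq', integral_const_mul]
    simp [hM]
  have hfin : ∫ z, Real.exp (g (x + s • z)) ∂(stdGaussian E)
      = Real.exp A * ∫ z, Real.exp (g (x + s • z) - A) ∂(stdGaussian E) := by
    rw [← integral_const_mul]
    refine integral_congr_ae (ae_of_all _ fun z => ?_)
    simp only
    rw [← Real.exp_add]; ring_nf
  rw [hfin]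
  gcongr
  refine hmain.trans ?_
  have h1 : ‖a x‖ ^ 2 ≤ L ^ 2 := by gcongr; exact hg.norm_grad_le x
  have h2 : s ^ 2 / 2 * ‖a x‖ ^ 2 ≤ s ^ 2 / 2 * L ^ 2 := by gcongr
  have h3 := Real.add_one_le_exp (s ^ 2 * (L ^ 2 / 2) + s ^ 3 * M)
  linarith

/-- The integral form of `conv_map_smul_stdGaussian`. -/
theorem integral_comp_smul_add_smul_stdGaussian {h : E → ℝ} (hh : Continuous h) (c d : ℝ)
    (hi : Integrable (fun z => h (√(c ^ 2 + d ^ 2) • z)) (stdGaussian E)) :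
    ∫ z, h (√(c ^ 2 + d ^ 2) • z) ∂(stdGaussian E)
      = ∫ z, ∫ w, h (c • z + d • w) ∂(stdGaussian E) ∂(stdGaussian E) ∧
    Integrable (fun z => ∫ w, h (c • z + d • w) ∂(stdGaussian E)) (stdGaussian E) := by
  have e : (stdGaussian E).map (fun z => √(c ^ 2 + d ^ 2) • z)
      = ((stdGaussian E).prod (stdGaussian E)).map (fun p => c • p.1 + d • p.2) := by
    rw [← conv_map_smul_stdGaussian, Measure.conv,
      Measure.map_prod_map _ _ (by fun_prop) (by fun_prop),
      Measure.map_map (by fun_prop) (by fun_prop)]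
    rfl
  have hi' : Integrable (fun p : E × E => h (c • p.1 + d • p.2))
      ((stdGaussian E).prod (stdGaussian E)) := by
    have h1 : Integrable h ((stdGaussian E).map (fun z => √(c ^ 2 + d ^ 2) • z)) :=
      (integrable_map_measure (by fun_prop) (by fun_prop)).2 hi
    rw [e] at h1
    exact (integrable_map_measure (by fun_prop) (by fun_prop)).1 h1
  refine ⟨?_, hi'.integral_prod_left⟩
  rw [← integral_prod _ hi', ← integral_map (f := h) (φ := fun z => √(c ^ 2 + d ^ 2) • z)
    (by fun_prop) (by fun_prop), e, integral_map (by fun_prop) (by fun_prop)]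

/-- **Gaussian concentration**: the exponential moment of a smooth `L`-Lipschitz function of a
standard Gaussian vector is at most that of a Gaussian variable of the same mean and of
variance `L ^ 2`. -/
theorem IsSmoothLipschitz.integral_exp_le {g : E → ℝ} {a : E → E} {L K : ℝ}
    (hg : IsSmoothLipschitz g a L K) (hK : 0 ≤ K) :
    ∫ z, Real.exp (g z) ∂(stdGaussian E)
      ≤ Real.exp (∫ z, g z ∂(stdGaussian E) + L ^ 2 / 2) := by
  obtain ⟨M, hM⟩ := exists_integral_exp_step_le (E := E) hg.nonneg hK
  -- `k` independent steps of size `s` make a step of size `√k * s`; averaging over one of them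
  -- leaves a function of the same class, to which the induction hypothesis applies
  have hiter : ∀ s : ℝ, 0 ≤ s → s ≤ 1 → ∀ k : ℕ, ∀ (g : E → ℝ) (a : E → E),
      IsSmoothLipschitz g a L K →
      ∫ z, Real.exp (g ((√k * s) • z)) ∂(stdGaussian E)
        ≤ Real.exp (∫ z, g ((√k * s) • z) ∂(stdGaussian E))
          * Real.exp (k * (s ^ 2 * (L ^ 2 / 2) + s ^ 3 * M)) := by
    intro s hs hs1 k
    induction k with
    | zero => intro g a _; simp
    | succ k ih =>
      intro g a hg
      have hk : √((k + 1 : ℕ) : ℝ) * s = √((√k * s) ^ 2 + s ^ 2) := by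
        rw [mul_pow, Real.sq_sqrt (Nat.cast_nonneg k), ← add_one_mul,
          Real.sqrt_mul (by positivity), Real.sqrt_sq hs]
        push_cast; rfl
      have hgc := hg.continuous
      have hav := hg.gaussianAverage s
      have hie := hg.integrable_exp 0 (√((√k * s) ^ 2 + s ^ 2))
      have hig := hg.integrable 0 (√((√k * s) ^ 2 + s ^ 2))
      have hie' := hav.integrable_exp 0 (√k * s)
      simp only [zero_add] at hie hig hie'
      obtain ⟨e1, i1⟩ := integral_comp_smul_add_smul_stdGaussian
        (h := fun z => Real.exp (g z)) (by fun_prop) _ _ hie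
      obtain ⟨e2, -⟩ := integral_comp_smul_add_smul_stdGaussian hgc _ _ hig
      rw [hk, e1, e2]
      calc ∫ z, ∫ w, Real.exp (g ((√k * s) • z + s • w)) ∂(stdGaussian E) ∂(stdGaussian E)
          ≤ ∫ z, Real.exp (∫ w, g ((√k * s) • z + s • w) ∂(stdGaussian E))
              * Real.exp (s ^ 2 * (L ^ 2 / 2) + s ^ 3 * M) ∂(stdGaussian E) :=
            integral_mono i1 (hie'.mul_const _) fun z => hM g a hg s hs hs1 _
        _ = (∫ z, Real.exp (∫ w, g ((√k * s) • z + s • w) ∂(stdGaussian E)) ∂(stdGaussian E))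
              * Real.exp (s ^ 2 * (L ^ 2 / 2) + s ^ 3 * M) := integral_mul_const _ _
        _ ≤ _ := mul_le_mul_of_nonneg_right (ih _ _ hav) (Real.exp_nonneg _)
        _ = _ := by
          rw [mul_assoc, ← Real.exp_add]
          push_cast
          ring_nf
  -- `N + 1` steps of size `1 / √(N + 1)`: the cubic errors add up to `M / √(N + 1)`
  have hN : ∀ N : ℕ, ∫ z, Real.exp (g z) ∂(stdGaussian E)
      ≤ Real.exp (∫ z, g z ∂(stdGaussian E) + (L ^ 2 / 2 + (√((N : ℝ) + 1))⁻¹ * M)) := by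
    intro N
    have hp : 0 < √((N : ℝ) + 1) := by positivity
    have hone : 1 ≤ √((N : ℝ) + 1) := Real.one_le_sqrt.2 (by linarith [N.cast_nonneg (α := ℝ)])
    have h := hiter (√((N : ℝ) + 1))⁻¹ (by positivity) (inv_le_one_of_one_le₀ hone) (N + 1) g a hg
    push_cast at h
    rw [mul_inv_cancel₀ hp.ne'] at h
    simp only [one_smul] at h
    rw [← Real.exp_add] at h
    have hsq := Real.sq_sqrt (show 0 ≤ (N : ℝ) + 1 by positivity)
    have e : ((N : ℝ) + 1) * ((√((N : ℝ) + 1))⁻¹ ^ 2 * (L ^ 2 / 2) + (√((N : ℝ) + 1))⁻¹ ^ 3 * M)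
        = L ^ 2 / 2 + (√((N : ℝ) + 1))⁻¹ * M := by
      nth_rewrite 1 [← hsq]
      field_simp
    rwa [e] at h
  have hlim : Filter.Tendsto (fun N : ℕ => Real.exp (∫ z, g z ∂(stdGaussian E)
      + (L ^ 2 / 2 + (√((N : ℝ) + 1))⁻¹ * M))) Filter.atTop
      (nhds (Real.exp (∫ z, g z ∂(stdGaussian E) + (L ^ 2 / 2 + 0 * M)))) := by
    have h0 : Filter.Tendsto (fun N : ℕ => (√((N : ℝ) + 1))⁻¹) Filter.atTop (nhds 0) :=
      Filter.Tendsto.comp tendsto_inv_atTop_zero (Real.tendsto_sqrt_atTop.comp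
        (Filter.tendsto_atTop_add_const_right _ _ tendsto_natCast_atTop_atTop))
    exact (Real.continuous_exp.tendsto _).comp (((h0.mul_const M).const_add _).const_add _)
  rw [zero_mul, add_zero] at hlim
  exact ge_of_tendsto' hlim hN

end Concentration

/-! ### The sign maximum and its semidefinite relaxation -/

section Relaxation

variable {n m : ℕ} (F : Matrix (Fin n) (Fin m) ℝ)

theorem dotProduct_mul_transpose_mulVec (v w : Fin n → ℝ) :
    v ⬝ᵥ ((F * Fᵀ) *ᵥ w) = (Fᵀ *ᵥ v) ⬝ᵥ (Fᵀ *ᵥ w) := by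
  rw [← mulVec_mulVec, dotProduct_mulVec, ← mulVec_transpose]

theorem quadForm_eq_norm_sq (v : Fin n → ℝ) :
    v ⬝ᵥ ((F * Fᵀ) *ᵥ v) = ‖WithLp.toLp 2 (Fᵀ *ᵥ v)‖ ^ 2 := by
  rw [dotProduct_mul_transpose_mulVec, EuclideanSpace.real_norm_sq_eq, dotProduct]
  exact Finset.sum_congr rfl fun i _ => (pow_two _).symm

theorem quadForm_nonneg (v : Fin n → ℝ) : 0 ≤ v ⬝ᵥ ((F * Fᵀ) *ᵥ v) := by
  rw [quadForm_eq_norm_sq]; positivity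

theorem quadForm_eq_sum (A : Matrix (Fin n) (Fin n) ℝ) (v w : Fin n → ℝ) :
    v ⬝ᵥ (A *ᵥ w) = ∑ i, ∑ j, A i j * (v i * w j) := by
  simp only [dotProduct, mulVec, Finset.mul_sum]
  exact Finset.sum_congr rfl fun i _ => Finset.sum_congr rfl fun j _ => by ring

theorem finite_setOf_forall_eq_or {ι : Type*} [Finite ι] (a b : ℝ) :
    {v : ι → ℝ | ∀ i, v i = a ∨ v i = b}.Finite := by
  have h : (Set.univ.pi fun _ : ι => ({a, b} : Set ℝ)).Finite :=
    Set.Finite.pi fun _ => by simp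
  refine h.subset fun v hv i _ => ?_
  simpa using hv i

theorem isGreatest_LSq : IsGreatest (signValues F) (LSq F) := by
  have hfin : (signValues F).Finite := by
    refine ((finite_setOf_forall_eq_or (ι := Fin n) (-1) 1).image
      fun v => v ⬝ᵥ ((F * Fᵀ) *ᵥ v)).subset ?_
    rintro t ⟨v, hv, rfl⟩
    exact ⟨v, hv, rfl⟩
  have hne : (signValues F).Nonempty := ⟨_, fun _ => 1, fun _ => Or.inr rfl, rfl⟩
  exact ⟨hne.csSup_mem hfin, fun t ht => le_csSup hfin.bddAbove ht⟩

theorem isGreatest_sigmaSq (k : ℕ) : IsGreatest (sparseValues k F) (sigmaSq k F) := by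
  have hfin : (sparseValues k F).Finite := by
    refine ((finite_setOf_forall_eq_or (ι := Fin 2 × Fin n) 0 1).image fun u =>
      u ⬝ᵥ (((!![1, -1; -1, 1] : Matrix (Fin 2) (Fin 2) ℝ) ⊗ₖ (F * Fᵀ)) *ᵥ u)).subset ?_
    rintro t ⟨u, hu, -, rfl⟩
    exact ⟨u, hu, rfl⟩
  have hne : (sparseValues k F).Nonempty :=
    ⟨_, fun _ => 0, fun _ => Or.inl rfl, by simp, rfl⟩
  exact ⟨hne.csSup_mem hfin, fun t ht => le_csSup hfin.bddAbove ht⟩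

theorem LSq_nonneg : 0 ≤ LSq F := by
  obtain ⟨v, -, hv⟩ := (isGreatest_LSq F).1
  rw [hv]
  exact quadForm_nonneg F v

/-- The convex function `w ↦ ‖Fᵀ w‖` attains its maximum over the cube at a vertex. -/
theorem norm_sq_le_LSq {w : Fin n → ℝ} (hw : ∀ i, |w i| ≤ 1) :
    ‖WithLp.toLp 2 (Fᵀ *ᵥ w)‖ ^ 2 ≤ LSq F := by
  have hconv : ConvexOn ℝ Set.univ fun v : Fin n → ℝ => ‖WithLp.toLp 2 (Fᵀ *ᵥ v)‖ :=
    (convexOn_univ_norm (E := EuclideanSpace ℝ (Fin m))).comp_linearMap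
      ((WithLp.linearEquiv 2 ℝ (Fin m → ℝ)).symm.toLinearMap ∘ₗ Fᵀ.mulVecLin)
  have hmem : w ∈ convexHull ℝ (Set.univ.pi fun _ : Fin n => ({-1, 1} : Set ℝ)) := by
    rw [convexHull_pi]
    intro i _
    rw [convexHull_pair, segment_eq_Icc (by norm_num)]
    exact abs_le.1 (hw i)
  obtain ⟨v, hv, hle⟩ := hconv.exists_ge_of_mem_convexHull (Set.subset_univ _) hmem
  calc ‖WithLp.toLp 2 (Fᵀ *ᵥ w)‖ ^ 2 ≤ ‖WithLp.toLp 2 (Fᵀ *ᵥ v)‖ ^ 2 := by gcongr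
    _ ≤ LSq F := (isGreatest_LSq F).2
      ⟨v, fun i => by simpa using hv i (Set.mem_univ i), (quadForm_eq_norm_sq F v).symm⟩

theorem kronecker_quadForm_eq (A : Matrix (Fin n) (Fin n) ℝ) (u : Fin 2 × Fin n → ℝ) :
    u ⬝ᵥ (((!![1, -1; -1, 1] : Matrix (Fin 2) (Fin 2) ℝ) ⊗ₖ A) *ᵥ u)
      = (fun i => u (0, i) - u (1, i)) ⬝ᵥ (A *ᵥ fun i => u (0, i) - u (1, i)) := by
  rw [quadForm_eq_sum]
  simp only [dotProduct, mulVec, Fintype.sum_prod_type, Fin.sum_univ_two, kroneckerMap_apply,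
    Finset.mul_sum, ← Finset.sum_add_distrib, mul_add]
  refine Finset.sum_congr rfl fun i _ => Finset.sum_congr rfl fun j _ => ?_
  simp
  ring

/-- A sign vector is the difference of the indicators of its positive and negative parts, which
together have exactly `n` ones. -/
theorem LSq_eq_sigmaSq : LSq F = sigmaSq n F := by
  apply le_antisymm
  · obtain ⟨v, hv, e⟩ := (isGreatest_LSq F).1
    refine (isGreatest_sigmaSq F n).2
      ⟨fun p => (1 + (if p.1 = 0 then 1 else -1) * v p.2) / 2, fun p => ?_, ?_, ?_⟩
    · dsimp only
      rcases hv p.2 with h | h <;> rw [h] <;> split_ifs <;> norm_num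
    · simp only [Fintype.sum_prod_type, Fin.sum_univ_two, ← Finset.sum_add_distrib]
      refine le_of_eq ?_
      rw [Finset.sum_congr rfl (g := fun _ => (1 : ℝ)) fun i _ => ?_]
      · simp
      · simp; ring
    · rw [kronecker_quadForm_eq, e]
      have : (fun i => (1 + (if ((0 : Fin 2), i).1 = 0 then (1 : ℝ) else -1) * v i) / 2
          - (1 + (if ((1 : Fin 2), i).1 = 0 then (1 : ℝ) else -1) * v i) / 2) = v := by
        ext i; simp; ring
      rw [this]
  · obtain ⟨u, hu, -, e⟩ := (isGreatest_sigmaSq F n).1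
    rw [e, kronecker_quadForm_eq, quadForm_eq_norm_sq]
    refine norm_sq_le_LSq F fun i => ?_
    rcases hu (0, i) with h | h <;> rcases hu (1, i) with h' | h' <;> simp [h, h']

open scoped MatrixOrder in
/-- A positive semidefinite matrix is a Gram matrix. -/
theorem exists_gram_of_posSemidef {X : Matrix (Fin n) (Fin n) ℝ} (hX : X.PosSemidef) :
    ∃ b : Fin n → EuclideanSpace ℝ (Fin n), ∀ i j, X i j = ⟪b i, b j⟫ := by
  obtain ⟨B, rfl⟩ := CStarAlgebra.nonneg_iff_eq_star_mul_self.1 hX.nonneg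
  refine ⟨fun i => WithLp.toLp 2 fun k => B k i, fun i j => ?_⟩
  simp [Matrix.mul_apply, PiLp.inner_apply, star_eq_conjTranspose, mul_comm]

theorem norm_eq_one_of_gram {X : Matrix (Fin n) (Fin n) ℝ} {b : Fin n → EuclideanSpace ℝ (Fin n)}
    (hb : ∀ i j, X i j = ⟪b i, b j⟫) (h1 : ∀ i, X i i = 1) (i : Fin n) : ‖b i‖ = 1 := by
  have h := h1 i
  rw [hb, real_inner_self_eq_norm_sq] at h
  exact (pow_eq_one_iff_of_nonneg (norm_nonneg _) two_ne_zero).1 h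

/-- The feasible set of the MaxCut semidefinite program is closed, and its members, being Gram
matrices of unit vectors, have entries in `[-1, 1]`. -/
theorem isCompact_mxct_feasible :
    IsCompact {X : Matrix (Fin n) (Fin n) ℝ | X.PosSemidef ∧ ∀ i, X i i = 1} := by
  have hK : IsCompact (Set.univ.pi fun _ : Fin n => Set.univ.pi fun _ : Fin n =>
      Set.Icc (-1 : ℝ) 1) :=
    isCompact_univ_pi fun _ => isCompact_univ_pi fun _ => isCompact_Icc
  refine hK.of_isClosed_subset ?_ ?_
  · have e : {X : Matrix (Fin n) (Fin n) ℝ | X.PosSemidef ∧ ∀ i, X i i = 1}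
        = {X | Xᴴ = X} ∩ (⋂ x : Fin n → ℝ, {X | 0 ≤ star x ⬝ᵥ (X *ᵥ x)})
          ∩ ⋂ i, {X | X i i = 1} := by
      ext X
      simp only [Set.mem_ofPred_eq, posSemidef_iff_dotProduct_mulVec, IsHermitian,
        Set.mem_inter_iff, Set.mem_iInter]
    rw [e]
    refine ((isClosed_eq (by fun_prop) (by fun_prop)).inter (isClosed_iInter fun x => ?_)).inter
      (isClosed_iInter fun i => isClosed_eq (by fun_prop) (by fun_prop))
    exact isClosed_le (by fun_prop) (by fun_prop)
  · rintro X ⟨hX, h1⟩ i - j -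
    obtain ⟨b, hb⟩ := exists_gram_of_posSemidef hX
    have h := abs_real_inner_le_norm (b i) (b j)
    rw [norm_eq_one_of_gram hb h1, norm_eq_one_of_gram hb h1, mul_one, ← hb] at h
    exact abs_le.1 h

theorem isGreatest_LmxctSq : IsGreatest (mxctValues F) (LmxctSq F) := by
  have e : mxctValues F = (fun X : Matrix (Fin n) (Fin n) ℝ => (X * (F * Fᵀ)).trace) ''
      {X | X.PosSemidef ∧ ∀ i, X i i = 1} := by
    ext t
    constructor
    · rintro ⟨X, hX, h1, rfl⟩
      exact ⟨X, ⟨hX, h1⟩, rfl⟩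
    · rintro ⟨X, ⟨hX, h1⟩, rfl⟩
      exact ⟨X, hX, h1, rfl⟩
  have hc : IsCompact (mxctValues F) := by
    rw [e]
    exact isCompact_mxct_feasible.image (by fun_prop)
  have hne : (mxctValues F).Nonempty := ⟨_, 1, PosSemidef.one, fun i => one_apply_eq i, rfl⟩
  exact hc.isGreatest_sSup hne

theorem LSq_le_LmxctSq : LSq F ≤ LmxctSq F := by
  obtain ⟨v, hv, e⟩ := (isGreatest_LSq F).1
  refine (isGreatest_LmxctSq F).2 ⟨vecMulVec v v, ?_, fun i => ?_, ?_⟩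
  · simpa using posSemidef_vecMulVec_self_star v
  · rcases hv i with h | h <;> simp [vecMulVec_apply, h]
  · rw [e, vecMulVec_mul, trace_vecMulVec, dotProduct_mulVec]
    exact dotProduct_comm _ _

theorem trace_mul_eq_sum (X : Matrix (Fin n) (Fin n) ℝ) :
    (X * (F * Fᵀ)).trace = ∑ i, ∑ j, (F * Fᵀ) i j * X i j := by
  have hsymm : ∀ i j, (F * Fᵀ) j i = (F * Fᵀ) i j := fun i j => by
    simp [Matrix.mul_apply, mul_comm]
  simp only [trace, diag_apply, Matrix.mul_apply (M := X)]
  exact Finset.sum_congr rfl fun i _ => Finset.sum_congr rfl fun j _ => by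
    rw [hsymm i j, mul_comm]

open scoped Matrix.Norms.L2Operator in
theorem spectralNorm₂_nonneg : 0 ≤ spectralNorm₂ F := norm_nonneg F

theorem trace_le_card_mul_spectralNorm_sq {X : Matrix (Fin n) (Fin n) ℝ} (hX : X.PosSemidef)
    (h1 : ∀ i, X i i = 1) : (X * (F * Fᵀ)).trace ≤ n * spectralNorm₂ F ^ 2 := by
  obtain ⟨b, hb⟩ := exists_gram_of_posSemidef hX
  have hT : ∀ v : Fin n → ℝ, ‖WithLp.toLp 2 (Fᵀ *ᵥ v)‖ ^ 2
      ≤ spectralNorm₂ F ^ 2 * ∑ i, v i ^ 2 := by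
    intro v
    have h : ‖WithLp.toLp 2 (Fᵀ *ᵥ v)‖ ≤ spectralNorm₂ F * ‖WithLp.toLp 2 v‖ := by
      have h2 := l2_opNorm_mulVec Fᵀ (WithLp.toLp 2 v)
      rw [← conjTranspose_eq_transpose_of_trivial, l2_opNorm_conjTranspose] at h2
      exact h2
    have h3 : ∑ i, v i ^ 2 = ‖WithLp.toLp 2 v‖ ^ 2 := by rw [EuclideanSpace.real_norm_sq_eq]
    rw [h3, ← mul_pow]
    gcongr
  -- coordinate by coordinate, the Gram representation turns the trace into a sum of squares
  have e : (X * (F * Fᵀ)).trace = ∑ k, ‖WithLp.toLp 2 (Fᵀ *ᵥ fun i => b i k)‖ ^ 2 := by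
    simp_rw [← quadForm_eq_norm_sq, quadForm_eq_sum]
    rw [trace_mul_eq_sum]
    symm
    rw [Finset.sum_comm]
    refine Finset.sum_congr rfl fun i _ => ?_
    rw [Finset.sum_comm]
    refine Finset.sum_congr rfl fun j _ => ?_
    rw [hb, PiLp.inner_apply, Finset.mul_sum]
    exact Finset.sum_congr rfl fun k _ => by simp [mul_comm]
  rw [e]
  calc ∑ k, ‖WithLp.toLp 2 (Fᵀ *ᵥ fun i => b i k)‖ ^ 2
      ≤ ∑ k, spectralNorm₂ F ^ 2 * ∑ i, b i k ^ 2 := Finset.sum_le_sum fun k _ => hT _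
    _ = spectralNorm₂ F ^ 2 * ∑ i, ∑ k, b i k ^ 2 := by rw [← Finset.mul_sum, Finset.sum_comm]
    _ = n * spectralNorm₂ F ^ 2 := by
      simp_rw [← EuclideanSpace.real_norm_sq_eq, norm_eq_one_of_gram hb h1]
      simp [mul_comm]

theorem Lmxct_le : Lmxct F ≤ √(n : ℝ) * spectralNorm₂ F := by
  obtain ⟨X, hX, h1, e⟩ := (isGreatest_LmxctSq F).1
  have h0 := spectralNorm₂_nonneg F
  have h := trace_le_card_mul_spectralNorm_sq F hX h1
  rw [← e] at h
  rw [Lmxct, ← Real.sqrt_sq h0, ← Real.sqrt_mul (Nat.cast_nonneg n)]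
  exact Real.sqrt_le_sqrt h

/-- Rounding by a random hyperplane: write the optimal `X` as the Gram matrix of unit vectors `b i`
and compare `s i = pmSign ⟪b i, z⟫` with the Gaussian vector `Z i = ⟪b i, z⟫`. The quadratic form
of `F Fᵀ` is nonnegative at `s - c Z`; with `c = √(2 / π)`, taking expectations gives the claim. -/
theorem two_div_pi_mul_LmxctSq_le : 2 / Real.pi * LmxctSq F ≤ LSq F := by
  obtain ⟨X, hX, h1, e⟩ := (isGreatest_LmxctSq F).1
  obtain ⟨b, hb⟩ := exists_gram_of_posSemidef hX
  have hn := norm_eq_one_of_gram hb h1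
  rw [e, trace_mul_eq_sum]
  set A := F * Fᵀ with hA
  set c := √(2 / Real.pi) with hc
  have hc2 : c * c = 2 / Real.pi := Real.mul_self_sqrt (by positivity)
  set γ := stdGaussian (EuclideanSpace ℝ (Fin n))
  have hpt : ∀ z : EuclideanSpace ℝ (Fin n),
      2 * c * ∑ i, ∑ j, A i j * (pmSign ⟪b i, z⟫ * ⟪b j, z⟫)
        ≤ LSq F + c * c * ∑ i, ∑ j, A i j * (⟪b i, z⟫ * ⟪b j, z⟫) := by
    intro z
    have hs : ∑ i, ∑ j, A i j * (pmSign ⟪b i, z⟫ * pmSign ⟪b j, z⟫) ≤ LSq F := by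
      rw [← quadForm_eq_sum A (fun i => pmSign ⟪b i, z⟫) fun j => pmSign ⟪b j, z⟫]
      exact (isGreatest_LSq F).2 ⟨_, fun i => pmSign_eq _, rfl⟩
    have hq := quadForm_nonneg F fun i => pmSign ⟪b i, z⟫ - c * ⟪b i, z⟫
    rw [← hA, quadForm_eq_sum] at hq
    have hsw : ∑ i, ∑ j, A i j * (⟪b i, z⟫ * pmSign ⟪b j, z⟫)
        = ∑ i, ∑ j, A i j * (pmSign ⟪b i, z⟫ * ⟪b j, z⟫) := by
      rw [Finset.sum_comm]
      refine Finset.sum_congr rfl fun i _ => Finset.sum_congr rfl fun j _ => ?_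
      have : A j i = A i j := by simp [hA, Matrix.mul_apply, mul_comm]
      rw [this]; ring
    have hex : ∑ i, ∑ j, A i j * ((pmSign ⟪b i, z⟫ - c * ⟪b i, z⟫)
          * (pmSign ⟪b j, z⟫ - c * ⟪b j, z⟫))
        = ∑ i, ∑ j, A i j * (pmSign ⟪b i, z⟫ * pmSign ⟪b j, z⟫)
          - c * ∑ i, ∑ j, A i j * (pmSign ⟪b i, z⟫ * ⟪b j, z⟫)
          - c * ∑ i, ∑ j, A i j * (⟪b i, z⟫ * pmSign ⟪b j, z⟫)
          + c * c * ∑ i, ∑ j, A i j * (⟪b i, z⟫ * ⟪b j, z⟫) := by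
      simp only [Finset.mul_sum, ← Finset.sum_add_distrib, ← Finset.sum_sub_distrib]
      exact Finset.sum_congr rfl fun i _ => Finset.sum_congr rfl fun j _ => by ring
    rw [hex, hsw] at hq
    linarith
  have hi1 : ∀ i j, Integrable (fun z => A i j * (pmSign ⟪b i, z⟫ * ⟪b j, z⟫)) γ := fun i j =>
    (integrable_pmSign_mul_inner_stdGaussian _ _).const_mul _
  have hi2 : ∀ i j, Integrable (fun z => A i j * (⟪b i, z⟫ * ⟪b j, z⟫)) γ := fun i j =>
    (integrable_inner_mul_inner_stdGaussian _ _).const_mul _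
  have hI1 : Integrable (fun z => ∑ i, ∑ j, A i j * (pmSign ⟪b i, z⟫ * ⟪b j, z⟫)) γ :=
    integrable_finsetSum _ fun i _ => integrable_finsetSum _ fun j _ => hi1 i j
  have hI2 : Integrable (fun z => ∑ i, ∑ j, A i j * (⟪b i, z⟫ * ⟪b j, z⟫)) γ :=
    integrable_finsetSum _ fun i _ => integrable_finsetSum _ fun j _ => hi2 i j
  have hint := integral_mono (hI1.const_mul (2 * c))
    ((integrable_const (LSq F)).add (hI2.const_mul (c * c))) hpt
  rw [integral_add' (integrable_const _) (hI2.const_mul (c * c)), integral_const_mul,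
    integral_const_mul] at hint
  have v1 : ∫ z, ∑ i, ∑ j, A i j * (pmSign ⟪b i, z⟫ * ⟪b j, z⟫) ∂γ
      = c * ∑ i, ∑ j, A i j * X i j := by
    rw [integral_finsetSum _ fun i _ => integrable_finsetSum _ fun j _ => hi1 i j, Finset.mul_sum]
    refine Finset.sum_congr rfl fun i _ => ?_
    rw [integral_finsetSum _ fun j _ => hi1 i j, Finset.mul_sum]
    refine Finset.sum_congr rfl fun j _ => ?_
    rw [integral_const_mul, integral_pmSign_mul_inner_stdGaussian (hn i), hb, ← hc]
    ring
  have v2 : ∫ z, ∑ i, ∑ j, A i j * (⟪b i, z⟫ * ⟪b j, z⟫) ∂γ = ∑ i, ∑ j, A i j * X i j := by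
    rw [integral_finsetSum _ fun i _ => integrable_finsetSum _ fun j _ => hi2 i j]
    refine Finset.sum_congr rfl fun i _ => ?_
    rw [integral_finsetSum _ fun j _ => hi2 i j]
    refine Finset.sum_congr rfl fun j _ => ?_
    rw [integral_const_mul, integral_inner_mul_inner_stdGaussian, hb]
  rw [v1, v2] at hint
  simp only [integral_const, probReal_univ, one_smul] at hint
  rw [← hc2]
  linarith

end Relaxation

/-! ### The lower tail of the `ℓ₁` norm -/

/-- The first-order expansion of `t ↦ √(t ^ 2 + ε ^ 2)`: the error is nonnegative, by convexity,
and at most `h ^ 2 / (2 ε)`. -/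
theorem sqrt_sq_add_sq_taylor {ε : ℝ} (hε : 0 < ε) (t h : ℝ) :
    0 ≤ √((t + h) ^ 2 + ε ^ 2) - √(t ^ 2 + ε ^ 2) - t / √(t ^ 2 + ε ^ 2) * h ∧
    √((t + h) ^ 2 + ε ^ 2) - √(t ^ 2 + ε ^ 2) - t / √(t ^ 2 + ε ^ 2) * h ≤ h ^ 2 / (2 * ε) := by
  have hA2 := Real.sq_sqrt (show 0 ≤ t ^ 2 + ε ^ 2 by positivity)
  have hB2 := Real.sq_sqrt (show 0 ≤ (t + h) ^ 2 + ε ^ 2 by positivity)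
  have hA : ε ≤ √(t ^ 2 + ε ^ 2) := Real.le_sqrt_of_sq_le (by linarith [sq_nonneg t])
  have hB : 0 ≤ √((t + h) ^ 2 + ε ^ 2) := Real.sqrt_nonneg _
  set A := √(t ^ 2 + ε ^ 2)
  set B := √((t + h) ^ 2 + ε ^ 2)
  have hA0 : 0 < A := hε.trans_le hA
  have e : B - A - t / A * h = (h ^ 2 - (A - B) ^ 2) / (2 * A) := by
    field_simp
    linarith
  have hAB : (A - B) ^ 2 ≤ h ^ 2 := by
    -- Cauchy–Schwarz for `(t, ε)` and `(t + h, ε)`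
    have h1 : t * (t + h) + ε ^ 2 ≤ A * B := by
      refine le_of_abs_le (abs_le_of_sq_le_sq ?_ (by positivity))
      rw [mul_pow, hA2, hB2]
      linarith [sq_nonneg (ε * h)]
    linarith
  rw [e]
  constructor
  · exact div_nonneg (by linarith) (by positivity)
  · gcongr
    linarith [sq_nonneg (A - B)]

section LowerTail

variable {n m : ℕ} (F : Matrix (Fin n) (Fin m) ℝ)

/-- The `i`-th row of `F` as a vector of Euclidean space. -/
noncomputable def rowVec (i : Fin n) : EuclideanSpace ℝ (Fin m) := WithLp.toLp 2 (F.row i)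

theorem mulVec_apply_eq_inner (y : EuclideanSpace ℝ (Fin m)) (i : Fin n) :
    (F *ᵥ y.ofLp) i = ⟪rowVec F i, y⟫ := by
  simp [rowVec, PiLp.inner_apply, mulVec, dotProduct, mul_comm]

theorem l1Norm_mulVec (y : EuclideanSpace ℝ (Fin m)) :
    l1Norm (F *ᵥ y.ofLp) = ∑ i, |⟪rowVec F i, y⟫| := by
  simp only [l1Norm, mulVec_apply_eq_inner]

theorem sum_smul_rowVec (w : Fin n → ℝ) :
    ∑ i, w i • rowVec F i = WithLp.toLp 2 (Fᵀ *ᵥ w) := by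
  ext k
  simp [rowVec, mulVec, dotProduct, mul_comm]

/-- A smooth approximation of `y ↦ ‖F y‖₁`, from above. -/
noncomputable def smoothL1 (ε : ℝ) (y : EuclideanSpace ℝ (Fin m)) : ℝ :=
  ∑ i, √(⟪rowVec F i, y⟫ ^ 2 + ε ^ 2)

/-- The gradient of `smoothL1 F ε`. -/
noncomputable def smoothL1Grad (ε : ℝ) (y : EuclideanSpace ℝ (Fin m)) :
    EuclideanSpace ℝ (Fin m) :=
  ∑ i, (⟪rowVec F i, y⟫ / √(⟪rowVec F i, y⟫ ^ 2 + ε ^ 2)) • rowVec F i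

theorem l1Norm_le_smoothL1 (ε : ℝ) (y : EuclideanSpace ℝ (Fin m)) :
    l1Norm (F *ᵥ y.ofLp) ≤ smoothL1 F ε y := by
  rw [l1Norm_mulVec]
  refine Finset.sum_le_sum fun i _ => Real.le_sqrt_of_sq_le ?_
  rw [sq_abs]
  linarith [sq_nonneg ε]

theorem smoothL1_le {ε : ℝ} (hε : 0 ≤ ε) (y : EuclideanSpace ℝ (Fin m)) :
    smoothL1 F ε y ≤ l1Norm (F *ᵥ y.ofLp) + n * ε := by
  have e : (n : ℝ) * ε = ∑ _i : Fin n, ε := by simp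
  rw [l1Norm_mulVec, e, ← Finset.sum_add_distrib]
  refine Finset.sum_le_sum fun i _ => Real.sqrt_le_iff.2 ⟨by positivity, ?_⟩
  rw [add_sq, sq_abs]
  have := abs_nonneg ⟪rowVec F i, y⟫
  have : 0 ≤ 2 * |⟪rowVec F i, y⟫| * ε := by positivity
  linarith

/-- The gradient is `Fᵀ w` for a point `w` of the cube. -/
theorem norm_smoothL1Grad_le (ε : ℝ) (y : EuclideanSpace ℝ (Fin m)) :
    ‖smoothL1Grad F ε y‖ ≤ √(LSq F) := by
  rw [smoothL1Grad, sum_smul_rowVec F fun i => ⟪rowVec F i, y⟫ / √(⟪rowVec F i, y⟫ ^ 2 + ε ^ 2)]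
  refine Real.le_sqrt_of_sq_le (norm_sq_le_LSq F fun i => ?_)
  rw [abs_div, abs_of_nonneg (Real.sqrt_nonneg _)]
  refine div_le_one_of_le₀ (Real.le_sqrt_of_sq_le ?_) (Real.sqrt_nonneg _)
  rw [sq_abs]
  linarith [sq_nonneg ε]

theorem smoothL1_taylor {ε : ℝ} (hε : 0 < ε) (y h : EuclideanSpace ℝ (Fin m)) :
    0 ≤ smoothL1 F ε (y + h) - smoothL1 F ε y - ⟪smoothL1Grad F ε y, h⟫ ∧
    smoothL1 F ε (y + h) - smoothL1 F ε y - ⟪smoothL1Grad F ε y, h⟫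
      ≤ (∑ i, ‖rowVec F i‖ ^ 2) / (2 * ε) * ‖h‖ ^ 2 := by
  simp only [smoothL1, smoothL1Grad, sum_inner, real_inner_smul_left, ← Finset.sum_sub_distrib,
    inner_add_right, Finset.sum_div, Finset.sum_mul]
  refine ⟨Finset.sum_nonneg fun i _ => (sqrt_sq_add_sq_taylor hε _ _).1,
    Finset.sum_le_sum fun i _ => (sqrt_sq_add_sq_taylor hε _ _).2.trans ?_⟩
  rw [div_mul_eq_mul_div, ← mul_pow, ← sq_abs]
  gcongr
  exact abs_real_inner_le_norm _ _

theorem abs_smoothL1_sub_le {ε : ℝ} (hε : 0 < ε) (y h : EuclideanSpace ℝ (Fin m)) :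
    |smoothL1 F ε (y + h) - smoothL1 F ε y| ≤ √(LSq F) * ‖h‖ := by
  -- the supporting hyperplanes at `y` and at `y + h` bound the increment from both sides
  have key : ∀ x k : EuclideanSpace ℝ (Fin m),
      smoothL1 F ε x - smoothL1 F ε (x + k) ≤ √(LSq F) * ‖k‖ := by
    intro x k
    have h1 := (smoothL1_taylor F hε x k).1
    have h2 : |⟪smoothL1Grad F ε x, k⟫| ≤ √(LSq F) * ‖k‖ :=
      (abs_real_inner_le_norm _ _).trans (by gcongr; exact norm_smoothL1Grad_le F ε x)
    linarith [neg_abs_le ⟪smoothL1Grad F ε x, k⟫]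
  have h1 := key y h
  have h2 := key (y + h) (-h)
  rw [add_neg_cancel_right, norm_neg] at h2
  exact abs_le.2 ⟨by linarith, h2⟩

theorem isSmoothLipschitz_const_mul_smoothL1 {ε : ℝ} (hε : 0 < ε) (c : ℝ) :
    IsSmoothLipschitz (fun y => c * smoothL1 F ε y) (fun y => c • smoothL1Grad F ε y)
      (|c| * √(LSq F)) (|c| * ((∑ i, ‖rowVec F i‖ ^ 2) / (2 * ε))) where
  measurable_grad := by unfold smoothL1Grad; fun_prop
  norm_grad_le y := by
    rw [norm_smul, Real.norm_eq_abs]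
    gcongr
    exact norm_smoothL1Grad_le F ε y
  abs_sub_le y h := by
    rw [← mul_sub, abs_mul, mul_assoc]
    gcongr
    exact abs_smoothL1_sub_le F hε y h
  abs_taylor_le y h := by
    obtain ⟨h1, h2⟩ := smoothL1_taylor F hε y h
    rw [real_inner_smul_left, ← mul_sub, ← mul_sub, abs_mul, abs_of_nonneg h1, mul_assoc]
    gcongr

theorem continuous_l1Norm_mulVec :
    Continuous fun y : EuclideanSpace ℝ (Fin m) => l1Norm (F *ᵥ y.ofLp) := by
  simp_rw [l1Norm_mulVec]
  fun_prop

theorem integrable_l1Norm_mulVec :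
    Integrable (fun y : EuclideanSpace ℝ (Fin m) => l1Norm (F *ᵥ y.ofLp))
      (stdGaussian (EuclideanSpace ℝ (Fin m))) := by
  simp_rw [l1Norm_mulVec]
  exact integrable_finsetSum _ fun i _ => (integrable_inner_stdGaussian _).abs

theorem integral_l1Norm_mulVec :
    ∫ y, l1Norm (F *ᵥ y.ofLp) ∂(stdGaussian (EuclideanSpace ℝ (Fin m)))
      = √(2 / Real.pi) * ∑ i, rowNorm F i := by
  simp_rw [l1Norm_mulVec]
  rw [integral_finsetSum _ fun i _ => (integrable_inner_stdGaussian _).abs, Finset.mul_sum]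
  exact Finset.sum_congr rfl fun i _ => integral_abs_inner_stdGaussian _

theorem integrable_exp_neg_l1Norm_mulVec {l : ℝ} (hl : 0 ≤ l) :
    Integrable (fun y : EuclideanSpace ℝ (Fin m) => Real.exp (-l * l1Norm (F *ᵥ y.ofLp)))
      (stdGaussian (EuclideanSpace ℝ (Fin m))) := by
  have hc := continuous_l1Norm_mulVec F
  refine (integrable_const (1 : ℝ)).mono'
    (Real.continuous_exp.comp (hc.const_mul (-l))).aestronglyMeasurable (ae_of_all _ fun y => ?_)
  rw [Real.norm_of_nonneg (Real.exp_nonneg _), Real.exp_le_one_iff, neg_mul, neg_nonpos]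
  exact mul_nonneg hl (Finset.sum_nonneg fun i _ => abs_nonneg _)

/-- The sub-Gaussian bound for the lower exponential moments of `‖F y‖₁`. -/
theorem mgf_neg_l1Norm_mulVec_le {l : ℝ} (hl : 0 ≤ l) :
    mgf (fun y : EuclideanSpace ℝ (Fin m) => l1Norm (F *ᵥ y.ofLp))
        (stdGaussian (EuclideanSpace ℝ (Fin m))) (-l)
      ≤ Real.exp (-l * ∫ y, l1Norm (F *ᵥ y.ofLp) ∂(stdGaussian (EuclideanSpace ℝ (Fin m)))
          + l ^ 2 * LSq F / 2) := by
  set γ := stdGaussian (EuclideanSpace ℝ (Fin m))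
  set μ := ∫ y, l1Norm (F *ᵥ y.ofLp) ∂γ with hμ
  have hε : ∀ ε : ℝ, 0 < ε → mgf (fun y : EuclideanSpace ℝ (Fin m) => l1Norm (F *ᵥ y.ofLp)) γ (-l)
      ≤ Real.exp (l * (n * ε) + (-l * μ + l ^ 2 * LSq F / 2)) := by
    intro ε hε
    have hg := isSmoothLipschitz_const_mul_smoothL1 F hε (-l)
    have hexp := hg.integral_exp_le (by positivity)
    have hi := hg.integrable_exp 0 1
    have hi1 := (isSmoothLipschitz_const_mul_smoothL1 F hε 1).integrable 0 1
    simp only [zero_add, one_smul, one_mul] at hi hi1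
    have hmean : μ ≤ ∫ y, smoothL1 F ε y ∂γ :=
      integral_mono (integrable_l1Norm_mulVec F) hi1 fun y => l1Norm_le_smoothL1 F ε y
    rw [integral_const_mul, mul_pow, Real.sq_sqrt (LSq_nonneg F), sq_abs, neg_sq] at hexp
    calc mgf (fun y : EuclideanSpace ℝ (Fin m) => l1Norm (F *ᵥ y.ofLp)) γ (-l)
        ≤ ∫ y, Real.exp (l * (n * ε)) * Real.exp (-l * smoothL1 F ε y) ∂γ := by
          refine integral_mono (integrable_exp_neg_l1Norm_mulVec F hl) (hi.const_mul _) fun y => ?_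
          simp only
          rw [← Real.exp_add, Real.exp_le_exp]
          have := mul_le_mul_of_nonneg_left (smoothL1_le F hε.le y) hl
          linarith
      _ = Real.exp (l * (n * ε)) * ∫ y, Real.exp (-l * smoothL1 F ε y) ∂γ :=
          integral_const_mul _ _
      _ ≤ Real.exp (l * (n * ε)) * Real.exp (-l * μ + l ^ 2 * LSq F / 2) := by
          gcongr
          refine hexp.trans (Real.exp_le_exp.2 ?_)
          have := mul_le_mul_of_nonneg_left hmean hl
          linarith
      _ = _ := by rw [← Real.exp_add]
  have hlim : Filter.Tendsto (fun ε : ℝ => Real.exp (l * (n * ε) + (-l * μ + l ^ 2 * LSq F / 2)))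
      (nhdsWithin 0 (Set.Ioi 0))
      (nhds (Real.exp (l * (n * 0) + (-l * μ + l ^ 2 * LSq F / 2)))) :=
    ((by fun_prop : Continuous fun ε : ℝ =>
      Real.exp (l * (n * ε) + (-l * μ + l ^ 2 * LSq F / 2))).tendsto 0).mono_left
      nhdsWithin_le_nhds
  rw [mul_zero, mul_zero, zero_add] at hlim
  exact ge_of_tendsto hlim (Filter.eventually_of_mem self_mem_nhdsWithin hε)

/-- The Chernoff bound with an arbitrary parameter `l`. -/
theorem measureReal_l1Norm_mulVec_le {l : ℝ} (hl : 0 ≤ l) (x : ℝ) :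
    (stdGaussian (EuclideanSpace ℝ (Fin m))).real {y | l1Norm (F *ᵥ y.ofLp) ≤
        (∫ y, l1Norm (F *ᵥ y.ofLp) ∂(stdGaussian (EuclideanSpace ℝ (Fin m)))) - x}
      ≤ Real.exp (-(l * x) + l ^ 2 * LSq F / 2) := by
  refine (measure_le_le_exp_mul_mgf _ (neg_nonpos.2 hl)
    (integrable_exp_neg_l1Norm_mulVec F hl)).trans ?_
  refine (mul_le_mul_of_nonneg_left (mgf_neg_l1Norm_mulVec_le F hl) (Real.exp_nonneg _)).trans ?_
  rw [← Real.exp_add, Real.exp_le_exp]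
  linarith

theorem measureReal_l1Norm_mulVec_le_exp_neg {x : ℝ} (hx : 0 ≤ x) :
    (stdGaussian (EuclideanSpace ℝ (Fin m))).real {y | l1Norm (F *ᵥ y.ofLp) ≤
        (∫ y, l1Norm (F *ᵥ y.ofLp) ∂(stdGaussian (EuclideanSpace ℝ (Fin m)))) - x}
      ≤ Real.exp (-(x ^ 2 / (2 * LSq F))) := by
  have h0 := LSq_nonneg F
  -- the exponent is minimal at `l = x / L²`; if `L² = 0`, division by zero makes the bound `1`
  refine (measureReal_l1Norm_mulVec_le F (div_nonneg hx h0) x).trans (Real.exp_le_exp.2 ?_)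
  rcases h0.eq_or_lt with h | h
  · simp [← h]
  · refine le_of_eq ?_
    field_simp
    ring

/-- For `L²(F) = 0`, let the parameter of the Chernoff bound tend to infinity. -/
theorem measureReal_l1Norm_mulVec_eq_zero (h0 : LSq F = 0) {x : ℝ} (hx : 0 < x) :
    (stdGaussian (EuclideanSpace ℝ (Fin m))).real {y | l1Norm (F *ᵥ y.ofLp) ≤
        (∫ y, l1Norm (F *ᵥ y.ofLp) ∂(stdGaussian (EuclideanSpace ℝ (Fin m)))) - x} = 0 := by
  refine le_antisymm ?_ measureReal_nonneg
  have hlim : Filter.Tendsto (fun l : ℝ => Real.exp (-(l * x))) Filter.atTop (nhds 0) :=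
    Real.tendsto_exp_neg_atTop_nhds_zero.comp (Filter.tendsto_id.atTop_mul_const hx)
  refine ge_of_tendsto hlim ((Filter.eventually_ge_atTop 0).mono fun l hl => ?_)
  simpa [h0] using measureReal_l1Norm_mulVec_le F hl x

end LowerTail

end MaxCutRelax

theorem mainTheorem7 {n m : ℕ} (F : Matrix (Fin n) (Fin m) ℝ)
    {Ω : Type*} [MeasurableSpace Ω] (P : Measure Ω) [IsProbabilityMeasure P]
    (y : Ω → EuclideanSpace ℝ (Fin m))
    (hy : HasLaw y (stdGaussian (EuclideanSpace ℝ (Fin m))) P) :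
    -- the mean of `‖F y‖₁`
    (Integrable (fun ω => MaxCutRelax.l1Norm (F *ᵥ (y ω).ofLp)) P ∧
      ∫ ω, MaxCutRelax.l1Norm (F *ᵥ (y ω).ofLp) ∂P =
        √(2 / Real.pi) * ∑ i, MaxCutRelax.rowNorm F i) ∧
    -- the lower tail of `‖F y‖₁`; if `L²(F) = 0` and `x > 0`, the bound is read as `0`
    (∀ x : ℝ, 0 ≤ x →
      P.real {ω | MaxCutRelax.l1Norm (F *ᵥ (y ω).ofLp) ≤
          (∫ ω', MaxCutRelax.l1Norm (F *ᵥ (y ω').ofLp) ∂P) - x} ≤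
        Real.exp (-(x ^ 2 / (2 * MaxCutRelax.LSq F)))) ∧
    (MaxCutRelax.LSq F = 0 → ∀ x : ℝ, 0 < x →
      P.real {ω | MaxCutRelax.l1Norm (F *ᵥ (y ω).ofLp) ≤
          (∫ ω', MaxCutRelax.l1Norm (F *ᵥ (y ω').ofLp) ∂P) - x} = 0) ∧
    -- the three maxima are attained, and `L²(F) = σₙ²(F)`
    IsGreatest (MaxCutRelax.signValues F) (MaxCutRelax.LSq F) ∧
    IsGreatest (MaxCutRelax.sparseValues n F) (MaxCutRelax.sigmaSq n F) ∧
    IsGreatest (MaxCutRelax.mxctValues F) (MaxCutRelax.LmxctSq F) ∧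
    MaxCutRelax.LSq F = MaxCutRelax.sigmaSq n F ∧
    -- the MaxCut relaxation bounds
    2 / Real.pi * MaxCutRelax.LmxctSq F ≤ MaxCutRelax.LSq F ∧
    MaxCutRelax.LSq F ≤ MaxCutRelax.LmxctSq F ∧
    MaxCutRelax.Lmxct F ≤ √(n : ℝ) * MaxCutRelax.spectralNorm₂ F := by
  have hc := MaxCutRelax.continuous_l1Norm_mulVec F
  have hmean : ∫ ω, MaxCutRelax.l1Norm (F *ᵥ (y ω).ofLp) ∂P = ∫ z, MaxCutRelax.l1Norm (F *ᵥ z.ofLp)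
      ∂(stdGaussian (EuclideanSpace ℝ (Fin m))) :=
    hy.integral_comp hc.aestronglyMeasurable
  have htail : ∀ t : ℝ, P.real {ω | MaxCutRelax.l1Norm (F *ᵥ (y ω).ofLp) ≤ t}
      = (stdGaussian (EuclideanSpace ℝ (Fin m))).real
        {z | MaxCutRelax.l1Norm (F *ᵥ z.ofLp) ≤ t} := fun t =>
    hy.measureReal_eq (p := fun z => MaxCutRelax.l1Norm (F *ᵥ z.ofLp) ≤ t)
      (measurableSet_le hc.measurable measurable_const)
  simp_rw [htail, hmean]
  refine ⟨⟨?_, MaxCutRelax.integral_l1Norm_mulVec F⟩,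
    fun x hx => MaxCutRelax.measureReal_l1Norm_mulVec_le_exp_neg F hx,
    fun h x hx => MaxCutRelax.measureReal_l1Norm_mulVec_eq_zero F h hx,
    MaxCutRelax.isGreatest_LSq F, MaxCutRelax.isGreatest_sigmaSq F n,
    MaxCutRelax.isGreatest_LmxctSq F, MaxCutRelax.LSq_eq_sigmaSq F,
    MaxCutRelax.two_div_pi_mul_LmxctSq_le F, MaxCutRelax.LSq_le_LmxctSq F,
    MaxCutRelax.Lmxct_le F⟩
  have h := MaxCutRelax.integrable_l1Norm_mulVec F
  rw [← hy.map_eq] at h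
  exact h.comp_aemeasurable hy.aemeasurable
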